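/- Let $D$ be a finite digraph with vertex set $V$, without loops or repeated arcs, and write $vw$ for an arc from $v$ to $w$. For $v\in V$ let $N(v)$ be the set of vertices joined to $v$ by an arc in either direction, $N[v]=N(v)\cup\{v\}$, and $d^+(v)$ the out-degree of $v$. The digraph $\mathcal W(D)$ has as vertices: $x^*$ for each $x\in V$; and, for each arc $vw$ of $D$, $x^{vw}$ for each $x\in N(v)\triangle N(w)$ and $y_x^{vw}$ for each $x\in N(w)\setminus N[v]$ (all these vertices being distinct). Its arcs are, for each arc $vw$ of $D$: $v^*\to v^{vw}$; $v^{vw}\to x^{vw}$ for $x\in N(v)\setminus N(w)$; $v^{vw}\to y_x^{vw}$ and $y_x^{vw}\to x^{vw}$ for $x\in N(w)\setminus N[v]$; and $x^{vw}\to x^*$ for $x\in (N(v)\triangle N(w))\setminus\{v\}$. A digraph is Eulerian if the in-degree and the out-degree of every vertex agree (connectedness is not required). A subdigraph is spanning if it contains all the vertices, and even or odd according to the parity of its number of arcs. Let $EE(H)$ and $EO(H)$ be the numbers of even and of odd spanning Eulerian subdigraphs of a digraph $H$. Let $$f=\prod_{vw\in E(D)}\Big(\sum_{u\in N(w)\setminus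 N(v)}x_u-\sum_{u\in N(v)\setminus N(w)}x_u\Big)\in\mathbb R[x_v: v\in V],\qquad M_f=\prod_{v\in V}x_v^{d^+(v)}.$$ A term of the expansion of $f$ is a choice of one signed variable from each factor; it contributes the product of the chosen signed variables, and like terms are not collected. An occurrence of $+M_f$ (respectively $-M_f$) is a term whose product is $M_f$ (respectively $-M_f$). Then there is a bijection between the occurrences of $\pm M_f$ in the expansion of $f$ and the spanning Eulerian subdigraphs of $\mathcal W(D)$ under which the occurrences of $+M_f$ correspond exactly to the even subdigraphs and the occurrences of $-M_f$ exactly to the odd ones. Consequently, the coefficient of $M_f$ in $f$ is $EE(\mathcal W(D))-EO(\mathcal W(D))$. -/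

import Mathlib

namespace Digraph

variable {V : Type*}

/-- `N_D(v)`: the vertices adjacent to `v` in `D`, along an arc in either direction. -/
def nbr (D : Digraph V) (v : V) : Set V := {u | D.Adj v u ∨ D.Adj u v}

/-- `N_D[v] = N_D(v) ∪ {v}`. -/
def closedNbr (D : Digraph V) (v : V) : Set V := D.nbr v ∪ {v}

/-- The arcs `vw` of `D`, as ordered pairs `(v, w)` (tail, head). -/
abbrev Arc (D : Digraph V) : Type _ := {e : V × V // D.Adj e.1 e.2}

/-- The tail `v` of the arc `vw`. -/
abbrev Arc.tail {D : Digraph V} (e : D.Arc) : V := e.1.1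

/-- The head `w` of the arc `vw`. -/
abbrev Arc.head {D : Digraph V} (e : D.Arc) : V := e.1.2

/-- The out-degree `d⁺(v)`. -/
noncomputable def outDeg (D : Digraph V) (v : V) : ℕ := {u | D.Adj v u}.ncard

/-- The in-degree `d⁻(v)`. -/
noncomputable def inDeg (D : Digraph V) (v : V) : ℕ := {u | D.Adj u v}.ncard

/-- The number of arcs. -/
noncomputable def arcCount (D : Digraph V) : ℕ := {e : V × V | D.Adj e.1 e.2}.ncard

/-- Every vertex has equal out-degree and in-degree (connectedness is not required). -/
def IsEulerian (D : Digraph V) : Prop := ∀ v, D.outDeg v = D.inDeg v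

/-- The spanning Eulerian subdigraphs of `D`. A spanning subdigraph has the same vertex set as
`D`, so it is a digraph `S` on the same vertex type with `S ≤ D`. -/
abbrev SpanningEulerian (D : Digraph V) : Type _ := {S : Digraph V // S ≤ D ∧ S.IsEulerian}

/-- The number of spanning Eulerian subdigraphs with an even number of arcs. -/
noncomputable def EE (D : Digraph V) : ℕ := Nat.card {S : D.SpanningEulerian // Even S.1.arcCount}

/-- The number of spanning Eulerian subdigraphs with an odd number of arcs. -/
noncomputable def EO (D : Digraph V) : ℕ := Nat.card {S : D.SpanningEulerian // Odd S.1.arcCount}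

/-- The vertices of `𝒲(D)`: `star x` is `x^*`; for each arc `e = vw` of `D`, `sector e x` is
`x^{vw}` (for `x ∈ N(v) △ N(w)`) and `mid e x` is `y_x^{vw}` (for `x ∈ N(w) ∖ N[v]`). -/
inductive WVertex (D : Digraph V) : Type _
  | star (x : V) : WVertex D
  | sector (e : D.Arc) (x : V) (hx : x ∈ symmDiff (D.nbr e.tail) (D.nbr e.head)) : WVertex D
  | mid (e : D.Arc) (x : V) (hx : x ∈ D.nbr e.head \ D.closedNbr e.tail) : WVertex D

/-- The digraph `𝒲(D)`. Its arcs are, for `vw` ranging over the arcs of `D`: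
`v^* → v^{vw}`; `v^{vw} → x^{vw}` for `x ∈ N(v) ∖ N(w)`; `v^{vw} → y_x^{vw}` and
`y_x^{vw} → x^{vw}` for `x ∈ N(w) ∖ N[v]`; and `x^{vw} → x^*` for `x ≠ v`. -/
def W (D : Digraph V) : Digraph D.WVertex where
  Adj
    | .star a, .sector e x _ => a = e.tail ∧ x = e.tail
    | .sector e x _, .sector e' x' _ =>
        e = e' ∧ x = e.tail ∧ x' ∈ D.nbr e.tail \ D.nbr e.head
    | .sector e x _, .mid e' _ _ => e = e' ∧ x = e.tail
    | .mid e x _, .sector e' x' _ => e = e' ∧ x = x'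
    | .sector e x _, .star a => x ≠ e.tail ∧ a = x
    | _, _ => False

section Polynomial

variable [Fintype V]

open Classical in
/-- The polynomial `f`: the product over the arcs `vw` of
`∑_{u ∈ N(w) ∖ N(v)} x_u - ∑_{u ∈ N(v) ∖ N(w)} x_u`. -/
noncomputable def f (D : Digraph V) : MvPolynomial V ℝ :=
  ∏ e : D.Arc,
    (∑ u with u ∈ D.nbr e.head \ D.nbr e.tail, MvPolynomial.X u -
      ∑ u with u ∈ D.nbr e.tail \ D.nbr e.head, MvPolynomial.X u)

/-- The monomial `M_f = ∏_v x_v ^ d⁺(v)`. -/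
noncomputable def Mf (D : Digraph V) : MvPolynomial V ℝ :=
  ∏ v : V, MvPolynomial.X v ^ D.outDeg v

/-- The terms of the expansion of `f` before like terms are collected: a term is a choice, for
every arc `vw`, of one of the signed variables of the factor of `vw`; these variables are the
`x_u` with `u ∈ N(v) △ N(w)`, each occurring exactly once in that factor. -/
abbrev ExpansionTerm (D : Digraph V) : Type _ :=
  (e : D.Arc) → {u : V // u ∈ symmDiff (D.nbr e.tail) (D.nbr e.head)}

open Classical in
/-- The variable `x_u` with the sign that it has in the factor of the arc `vw`:
`+` if `u ∈ N(w) ∖ N(v)`, and `-` otherwise. -/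
noncomputable def signedVar (D : Digraph V) (e : D.Arc) (u : V) : MvPolynomial V ℝ :=
  if u ∈ D.nbr e.head \ D.nbr e.tail then MvPolynomial.X u else -MvPolynomial.X u

open Classical in
/-- The signed monomial that a term of the expansion contributes. -/
noncomputable def ExpansionTerm.value {D : Digraph V} (t : D.ExpansionTerm) : MvPolynomial V ℝ :=
  ∏ e : D.Arc, D.signedVar e (t e)

open Classical in
/-- `f` is the sum of the terms of its expansion. -/
theorem f_eq_sum_expansionTerm (D : Digraph V) :
    D.f = ∑ t : D.ExpansionTerm, ExpansionTerm.value t := by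
  unfold f ExpansionTerm.value
  rw [← Fintype.prod_sum (fun (e : D.Arc)
    (u : {u : V // u ∈ symmDiff (D.nbr e.tail) (D.nbr e.head)}) => D.signedVar e u)]
  refine Finset.prod_congr rfl fun e _ => ?_
  rw [← Finset.sum_subtype (Finset.univ.filter
    (fun u => u ∈ symmDiff (D.nbr e.tail) (D.nbr e.head))) (by simp) (D.signedVar e)]
  simp only [Finset.sum_filter, signedVar]
  rw [← Finset.sum_sub_distrib]
  refine Finset.sum_congr rfl fun u _ => ?_
  by_cases h1 : u ∈ D.nbr e.head <;> by_cases h2 : u ∈ D.nbr e.tail <;>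
    simp [h1, h2, Set.mem_symmDiff]

/-- The occurrences of `±M_f` in the expansion of `f`. -/
abbrev MfOccurrence (D : Digraph V) : Type _ :=
  {t : D.ExpansionTerm // ExpansionTerm.value t = D.Mf ∨ ExpansionTerm.value t = -D.Mf}

end Polynomial

end Digraph

namespace Digraph

variable {V : Type*}

/-! A term chooses one variable x_u for each arc vw. Send it to the union of the paths v^* → v^{vw}
→ u^{vw} → u^*, routed through y_u^{vw} when u ∈ N(w) ∖ N[v], with no path when u = v. As D is
loopless, x_v does occur in the factor of vw, with sign +. The paths have 3 arcs when the sign is -,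
and 4 or 0 when it is +, so the sign of the term is the parity of the number of arcs
(`signedVar_eq`). Interior vertices of the paths are balanced. At v^* balance says that as many arcs
leave v without choosing x_v as choose x_v without leaving v; adding the arcs that do both, the
exponent of x_v is d⁺(v) (`pathDigraph_isEulerian_iff`). So the terms ±M_f are those with Eulerian
image. Conversely, each v^{vw} has a single in-arc in 𝒲(D), so a spanning Eulerian subdigraph
contains at most one path for each arc vw, and every such subdigraph arises from a term
(`exists_pathDigraph_eq`). Summing over terms gives the coefficient. -/

instance WVertex.instFinite [Finite V] (D : Digraph V) : Finite D.WVertex := by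
  let g : D.WVertex → V ⊕ (D.Arc × V) ⊕ (D.Arc × V)
    | .star x => .inl x
    | .sector e x _ => .inr (.inl (e, x))
    | .mid e x _ => .inr (.inr (e, x))
  refine Finite.of_injective g ?_
  rintro (_ | _ | _) (_ | _ | _) h <;> simp_all [g]

/-! ### Balance at a single vertex -/

theorem IsEulerian.exists_out_iff_exists_in [Finite V] {D : Digraph V} (hE : D.IsEulerian)
    (v : V) : (∃ u, D.Adj v u) ↔ ∃ u, D.Adj u v := by
  have h := hE v
  unfold outDeg inDeg at h
  have h1 : {u | D.Adj v u}.ncard = 0 ↔ {u | D.Adj u v}.ncard = 0 := by rw [h]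
  rw [Set.ncard_eq_zero (Set.toFinite _), Set.ncard_eq_zero (Set.toFinite _)] at h1
  have h2 := not_congr h1
  rwa [← Ne, ← Ne, ← Set.nonempty_iff_ne_empty, ← Set.nonempty_iff_ne_empty] at h2

theorem IsEulerian.out_unique [Finite V] {D : Digraph V} (hE : D.IsEulerian) {v a b : V}
    (hin : {u | D.Adj u v}.Subsingleton) (ha : D.Adj v a) (hb : D.Adj v b) : a = b := by
  have h := hE v
  unfold outDeg inDeg at h
  have h1 := Set.ncard_le_one_iff_subsingleton.2 hin
  rw [← h] at h1
  exact Set.ncard_le_one_iff_subsingleton.1 h1 ha hb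

theorem outDeg_eq_inDeg_of_subsingleton {D : Digraph V} {v : V}
    (ho : {u | D.Adj v u}.Subsingleton) (hi : {u | D.Adj u v}.Subsingleton)
    (h : (∃ u, D.Adj v u) ↔ ∃ u, D.Adj u v) : D.outDeg v = D.inDeg v := by
  unfold outDeg inDeg
  rcases ho.eq_empty_or_singleton with h1 | ⟨a, h1⟩ <;>
    rcases hi.eq_empty_or_singleton with h2 | ⟨b, h2⟩
  · rw [h1, h2]
  · obtain ⟨u, hu⟩ := h.2 ⟨b, (h2.symm ▸ rfl : b ∈ {u | D.Adj u v})⟩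
    exact absurd (h1 ▸ hu : u ∈ (∅ : Set V)) (Set.notMem_empty u)
  · obtain ⟨u, hu⟩ := h.1 ⟨a, (h1.symm ▸ rfl : a ∈ {u | D.Adj v u})⟩
    exact absurd (h2 ▸ hu : u ∈ (∅ : Set V)) (Set.notMem_empty u)
  · rw [h1, h2, Set.ncard_singleton, Set.ncard_singleton]

variable {D : Digraph V}

/-! ### Neighbourhoods of the two ends of an arc -/

theorem notMem_nbr_self (hD : ∀ v, ¬ D.Adj v v) (v : V) : v ∉ D.nbr v := by
  simp [nbr, hD v]

theorem tail_mem_nbr_head (e : D.Arc) : e.tail ∈ D.nbr e.head := Or.inr e.2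

theorem tail_mem_symmDiff (hD : ∀ v, ¬ D.Adj v v) (e : D.Arc) :
    e.tail ∈ symmDiff (D.nbr e.tail) (D.nbr e.head) :=
  Or.inr ⟨tail_mem_nbr_head e, notMem_nbr_self hD _⟩

theorem mem_diff_closedNbr {e : D.Arc} {x : V}
    (hx : x ∈ symmDiff (D.nbr e.tail) (D.nbr e.head)) (hne : x ≠ e.tail)
    (h : x ∉ D.nbr e.tail \ D.nbr e.head) : x ∈ D.nbr e.head \ D.closedNbr e.tail := by
  rcases hx with hx | hx
  · exact absurd hx h
  · exact ⟨hx.1, by rintro (h' | h'); exacts [hx.2 h', hne h']⟩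

theorem mem_symmDiff_of_mem_diff_closedNbr {e : D.Arc} {x : V}
    (hx : x ∈ D.nbr e.head \ D.closedNbr e.tail) :
    x ∈ symmDiff (D.nbr e.tail) (D.nbr e.head) :=
  Or.inr ⟨hx.1, fun h => hx.2 (Or.inl h)⟩

theorem ne_tail_of_mem_diff_closedNbr {e : D.Arc} {x : V}
    (hx : x ∈ D.nbr e.head \ D.closedNbr e.tail) : x ≠ e.tail :=
  fun h => hx.2 (Or.inr h)

theorem ne_tail_of_mem_diff {e : D.Arc} {x : V}
    (hx : x ∈ D.nbr e.tail \ D.nbr e.head) : x ≠ e.tail := by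
  rintro rfl
  exact hx.2 (tail_mem_nbr_head e)

/-- The union of the paths `v^* → v^{vw} (→ y_u^{vw}) → u^{vw} → u^*` of `𝒲(D)`, over the arcs
`vw` at which the term `t` chooses a variable `x_u` with `u ≠ v`. -/
def pathDigraph (t : D.ExpansionTerm) : Digraph D.WVertex where
  Adj
    | .star a, .sector e x _ => a = e.tail ∧ x = e.tail ∧ (t e : V) ≠ e.tail
    | .sector e x _, .sector e' x' _ =>
        e = e' ∧ x = e.tail ∧ x' = t e ∧ x' ∈ D.nbr e.tail \ D.nbr e.head
    | .sector e x _, .mid e' x' _ => e = e' ∧ x = e.tail ∧ x' = t e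
    | .mid e x _, .sector e' x' _ => e = e' ∧ x = x' ∧ x = t e
    | .sector e x _, .star a => x ≠ e.tail ∧ a = x ∧ x = t e
    | _, _ => False

/-! ### From terms to unions of paths -/

theorem pathDigraph_le (t : D.ExpansionTerm) : pathDigraph t ≤ D.W := by
  rintro (_ | _ | _) (_ | _ | _) h <;> simp only [pathDigraph, W] at h ⊢ <;> grind

/-- The last arc u^{vw} → u^* of a path records the chosen variable; if there is no path for vw, the
choice was x_v. -/
theorem pathDigraph_injective : Function.Injective (pathDigraph (D := D)) := by
  have key : ∀ t t' : D.ExpansionTerm, pathDigraph t = pathDigraph t' → ∀ e : D.Arc,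
      (t e : V) ≠ e.tail → t e = t' e := by
    intro t t' h e hne
    have h1 : (pathDigraph t).Adj (.sector e (t e) (t e).2) (.star (t e)) := ⟨hne, rfl, rfl⟩
    rw [h] at h1
    exact Subtype.ext h1.2.2
  intro t t' h
  funext e
  by_cases h1 : (t e : V) = e.tail
  · by_cases h2 : (t' e : V) = e.tail
    · exact Subtype.ext (h1.trans h2.symm)
    · exact (key t' t h.symm e h2).symm
  · exact key t t' h e h1

/-! ### Balance in a union of paths -/

theorem outDeg_eq_ncard_arc (D : Digraph V) (v : V) :
    D.outDeg v = {e : D.Arc | e.tail = v}.ncard := by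
  unfold outDeg
  have hinj : Set.InjOn (fun e : D.Arc => e.head) {e : D.Arc | e.tail = v} :=
    fun e h1 e' h1' h2 => Subtype.ext (Prod.ext (h1.trans h1'.symm) h2)
  rw [← hinj.ncard_image]
  congr 1
  ext u
  constructor
  · intro h
    exact ⟨⟨(v, u), h⟩, rfl, rfl⟩
  · rintro ⟨e, rfl, rfl⟩
    exact e.2

theorem pathDigraph_outDeg_star (hD : ∀ v, ¬ D.Adj v v) (t : D.ExpansionTerm) (v : V) :
    (pathDigraph t).outDeg (.star v) =
      ({e : D.Arc | e.tail = v} \ {e | (t e : V) = v}).ncard := by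
  unfold outDeg
  rw [← Set.ncard_image_of_injective (f := fun e : D.Arc =>
    WVertex.sector e e.tail (tail_mem_symmDiff hD e)) (s := _ \ _)
    (fun e e' h => by simp only [WVertex.sector.injEq] at h; exact h.1)]
  congr 1
  ext u
  constructor
  · intro h
    rcases u with _ | ⟨e, x, hx⟩ | _
    · exact h.elim
    · obtain ⟨rfl, rfl, h⟩ := h
      exact ⟨e, ⟨rfl, h⟩, rfl⟩
    · exact h.elim
  · rintro ⟨e, ⟨h1, h2⟩, rfl⟩
    subst h1
    exact ⟨rfl, rfl, h2⟩

theorem pathDigraph_inDeg_star (t : D.ExpansionTerm) (v : V) :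
    (pathDigraph t).inDeg (.star v) =
      ({e : D.Arc | (t e : V) = v} \ {e | e.tail = v}).ncard := by
  unfold inDeg
  rw [← Set.ncard_image_of_injective (f := fun e : D.Arc =>
    WVertex.sector e (t e) (t e).2) (s := _ \ _)
    (fun e e' h => by simp only [WVertex.sector.injEq] at h; exact h.1)]
  congr 1
  ext u
  constructor
  · intro h
    rcases u with _ | ⟨e, x, hx⟩ | _
    · exact h.elim
    · obtain ⟨h, rfl, rfl⟩ := h
      exact ⟨e, ⟨rfl, Ne.symm h⟩, rfl⟩
    · exact h.elim
  · rintro ⟨e, ⟨h1, h2⟩, rfl⟩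
    subst h1
    exact ⟨Ne.symm h2, rfl, rfl⟩

/-- At most one path belongs to each arc of D, so an interior vertex has at most one arc in and one
out, and a path that enters it also leaves it. -/
theorem pathDigraph_outDeg_sector (hD : ∀ v, ¬ D.Adj v v) (t : D.ExpansionTerm) (e : D.Arc)
    (x : V) (hx : x ∈ symmDiff (D.nbr e.tail) (D.nbr e.head)) :
    (pathDigraph t).outDeg (.sector e x hx) = (pathDigraph t).inDeg (.sector e x hx) := by
  apply outDeg_eq_inDeg_of_subsingleton
  · rintro (a | ⟨e₁, a, ha⟩ | ⟨e₁, a, ha⟩) h₁ (b | ⟨e₂, b, hb⟩ | ⟨e₂, b, hb⟩) h₂ <;>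
      simp only [Set.mem_ofPred_eq, pathDigraph] at h₁ h₂ <;> grind [closedNbr]
  · rintro (a | ⟨e₁, a, ha⟩ | ⟨e₁, a, ha⟩) h₁ (b | ⟨e₂, b, hb⟩ | ⟨e₂, b, hb⟩) h₂ <;>
      simp only [Set.mem_ofPred_eq, pathDigraph] at h₁ h₂ <;>
      grind [closedNbr, ne_tail_of_mem_diff, ne_tail_of_mem_diff_closedNbr]
  · constructor
    · rintro ⟨u, hu⟩
      by_cases hxt : x = e.tail
      · refine ⟨.star e.tail, rfl, hxt, ?_⟩
        rcases u with a | ⟨e₁, a, ha⟩ | ⟨e₁, a, ha⟩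
        · exact absurd hxt hu.1
        · obtain ⟨rfl, -, h, h'⟩ := hu
          exact h ▸ ne_tail_of_mem_diff h'
        · obtain ⟨rfl, -, h⟩ := hu
          exact h ▸ ne_tail_of_mem_diff_closedNbr ha
      · have hxe : x = t e := by
          rcases u with a | ⟨e₁, a, ha⟩ | ⟨e₁, a, ha⟩
          · exact hu.2.2
          · exact absurd hu.2.1 hxt
          · exact absurd hu.2.1 hxt
        by_cases h : x ∈ D.nbr e.tail \ D.nbr e.head
        · exact ⟨.sector e e.tail (tail_mem_symmDiff hD e), rfl, rfl, hxe, h⟩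
        · exact ⟨.mid e x (mem_diff_closedNbr hx hxt h), rfl, rfl, hxe⟩
    · rintro ⟨u, hu⟩
      by_cases hxt : x = e.tail
      · have hne : (t e : V) ≠ e.tail := by
          rcases u with a | ⟨e₁, a, ha⟩ | ⟨e₁, a, ha⟩
          · exact hu.2.2
          · obtain ⟨rfl, -, -, h⟩ := hu
            exact absurd hxt (ne_tail_of_mem_diff h)
          · obtain ⟨rfl, rfl, -⟩ := hu
            exact absurd hxt (ne_tail_of_mem_diff_closedNbr ha)
        by_cases h : (t e : V) ∈ D.nbr e.tail \ D.nbr e.head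
        · exact ⟨.sector e (t e) (t e).2, rfl, hxt, rfl, h⟩
        · exact ⟨.mid e (t e) (mem_diff_closedNbr (t e).2 hne h), rfl, hxt, rfl⟩
      · refine ⟨.star x, hxt, rfl, ?_⟩
        rcases u with a | ⟨e₁, a, ha⟩ | ⟨e₁, a, ha⟩
        · exact absurd hu.2.1 hxt
        · obtain ⟨rfl, -, h, -⟩ := hu
          exact h
        · obtain ⟨rfl, rfl, h⟩ := hu
          exact h

theorem pathDigraph_outDeg_mid (hD : ∀ v, ¬ D.Adj v v) (t : D.ExpansionTerm) (e : D.Arc)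
    (x : V) (hx : x ∈ D.nbr e.head \ D.closedNbr e.tail) :
    (pathDigraph t).outDeg (.mid e x hx) = (pathDigraph t).inDeg (.mid e x hx) := by
  apply outDeg_eq_inDeg_of_subsingleton
  · rintro (a | ⟨e₁, a, ha⟩ | ⟨e₁, a, ha⟩) h₁ (b | ⟨e₂, b, hb⟩ | ⟨e₂, b, hb⟩) h₂
    all_goals simp only [Set.mem_ofPred_eq, pathDigraph] at h₁ h₂
    grind
  · rintro (a | ⟨e₁, a, ha⟩ | ⟨e₁, a, ha⟩) h₁ (b | ⟨e₂, b, hb⟩ | ⟨e₂, b, hb⟩) h₂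
    all_goals simp only [Set.mem_ofPred_eq, pathDigraph] at h₁ h₂
    grind
  · constructor
    · rintro ⟨u, hu⟩
      rcases u with a | ⟨e₁, a, ha⟩ | ⟨e₁, a, ha⟩
      · exact hu.elim
      · exact ⟨.sector e e.tail (tail_mem_symmDiff hD e), rfl, rfl, hu.2.2⟩
      · exact hu.elim
    · rintro ⟨u, hu⟩
      rcases u with a | ⟨e₁, a, ha⟩ | ⟨e₁, a, ha⟩
      · exact hu.elim
      · obtain ⟨rfl, -, h⟩ := hu
        exact ⟨.sector e₁ x (mem_symmDiff_of_mem_diff_closedNbr hx), rfl, rfl, h⟩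
      · exact hu.elim

/-- Only the vertices v^* impose a condition. Their two degrees count the set differences of {e :
tail v} and {e : choice v}, and these agree exactly when the two sets have the same size. -/
theorem pathDigraph_isEulerian_iff [Finite V] (hD : ∀ v, ¬ D.Adj v v) (t : D.ExpansionTerm) :
    (pathDigraph t).IsEulerian ↔ ∀ v, {e : D.Arc | (t e : V) = v}.ncard = D.outDeg v := by
  have star : ∀ v, (pathDigraph t).outDeg (.star v) = (pathDigraph t).inDeg (.star v) ↔
      {e : D.Arc | (t e : V) = v}.ncard = D.outDeg v := by
    intro v
    rw [pathDigraph_outDeg_star hD, pathDigraph_inDeg_star, outDeg_eq_ncard_arc,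
      ← Set.ncard_eq_ncard_iff_ncard_sdiff_eq_ncard_sdiff]
    exact eq_comm
  constructor
  · exact fun h v => (star v).1 (h _)
  · rintro h (v | ⟨e, x, hx⟩ | ⟨e, x, hx⟩)
    · exact (star v).2 (h v)
    · exact pathDigraph_outDeg_sector hD t e x hx
    · exact pathDigraph_outDeg_mid hD t e x hx

/-! ### Spanning Eulerian subdigraphs are unions of paths -/

theorem in_tail_subsingleton {S : Digraph D.WVertex} (hle : S ≤ D.W) (e : D.Arc)
    (ht : e.tail ∈ symmDiff (D.nbr e.tail) (D.nbr e.head)) :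
    {u | S.Adj u (.sector e e.tail ht)}.Subsingleton := by
  have key : ∀ u, S.Adj u (.sector e e.tail ht) → u = .star e.tail := by
    intro u hu
    have h2 := hle hu
    rcases u with a | ⟨e₁, a, ha⟩ | ⟨e₁, a, ha⟩
    · rw [h2.1]
    · obtain ⟨rfl, -, h2⟩ := h2
      exact absurd rfl (ne_tail_of_mem_diff h2)
    · obtain ⟨rfl, rfl⟩ := h2
      exact absurd rfl (ne_tail_of_mem_diff_closedNbr ha)
  intro a ha b hb
  rw [key a ha, key b hb]

section Surjective

variable [Finite V] {S : Digraph D.WVertex}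

/-- For x ≠ v, the vertex x^{vw} has only one possible in-arc and one possible out-arc in 𝒲(D), so
balance makes S contain both or neither. This and the next lemmas express every arc of S through the
final arcs x^{vw} → x^*. -/
theorem adj_mid_sector_iff (hle : S ≤ D.W) (hE : S.IsEulerian) {e : D.Arc} {x : V}
    (hx : x ∈ D.nbr e.head \ D.closedNbr e.tail)
    (hx' : x ∈ symmDiff (D.nbr e.tail) (D.nbr e.head)) :
    S.Adj (.mid e x hx) (.sector e x hx') ↔ S.Adj (.sector e x hx') (.star x) := by
  have hne := ne_tail_of_mem_diff_closedNbr hx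
  have h := hE.exists_out_iff_exists_in (.sector e x hx')
  constructor
  · intro h1
    obtain ⟨u, hu⟩ := h.2 ⟨_, h1⟩
    have h2 := hle hu
    rcases u with a | ⟨e₁, a, ha⟩ | ⟨e₁, a, ha⟩ <;> simp_all [W]
  · intro h1
    obtain ⟨u, hu⟩ := h.1 ⟨_, h1⟩
    have h2 := hle hu
    have h3 : x ∉ D.nbr e.tail := fun h => hx.2 (Or.inl h)
    rcases u with a | ⟨e₁, a, ha⟩ | ⟨e₁, a, ha⟩
    · exact absurd h2.2 hne
    · obtain ⟨rfl, -, h2⟩ := h2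
      exact absurd h2.1 h3
    · obtain ⟨rfl, rfl⟩ := h2
      exact hu

theorem adj_tail_sector_iff (hle : S ≤ D.W) (hE : S.IsEulerian) {e : D.Arc} {x : V}
    (hx : x ∈ D.nbr e.tail \ D.nbr e.head)
    (hx' : x ∈ symmDiff (D.nbr e.tail) (D.nbr e.head))
    (ht : e.tail ∈ symmDiff (D.nbr e.tail) (D.nbr e.head)) :
    S.Adj (.sector e e.tail ht) (.sector e x hx') ↔ S.Adj (.sector e x hx') (.star x) := by
  have hne := ne_tail_of_mem_diff hx
  have h := hE.exists_out_iff_exists_in (.sector e x hx')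
  constructor
  · intro h1
    obtain ⟨u, hu⟩ := h.2 ⟨_, h1⟩
    have h2 := hle hu
    rcases u with a | ⟨e₁, a, ha⟩ | ⟨e₁, a, ha⟩ <;> simp_all [W]
  · intro h1
    obtain ⟨u, hu⟩ := h.1 ⟨_, h1⟩
    have h2 := hle hu
    rcases u with a | ⟨e₁, a, ha⟩ | ⟨e₁, a, ha⟩
    · exact absurd h2.2 hne
    · obtain ⟨rfl, rfl, -⟩ := h2
      exact hu
    · obtain ⟨rfl, rfl⟩ := h2
      exact absurd hx.2 (not_not.2 ha.1)

theorem adj_tail_mid_iff (hle : S ≤ D.W) (hE : S.IsEulerian) {e : D.Arc} {x : V}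
    (hx : x ∈ D.nbr e.head \ D.closedNbr e.tail)
    (hx' : x ∈ symmDiff (D.nbr e.tail) (D.nbr e.head))
    (ht : e.tail ∈ symmDiff (D.nbr e.tail) (D.nbr e.head)) :
    S.Adj (.sector e e.tail ht) (.mid e x hx) ↔ S.Adj (.sector e x hx') (.star x) := by
  rw [← adj_mid_sector_iff hle hE hx hx']
  have h := hE.exists_out_iff_exists_in (.mid e x hx)
  constructor
  · intro h1
    obtain ⟨u, hu⟩ := h.2 ⟨_, h1⟩
    have h2 := hle hu
    rcases u with a | ⟨e₁, a, ha⟩ | ⟨e₁, a, ha⟩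
    · exact h2.elim
    · obtain ⟨rfl, rfl⟩ := h2
      exact hu
    · exact h2.elim
  · intro h1
    obtain ⟨u, hu⟩ := h.1 ⟨_, h1⟩
    have h2 := hle hu
    rcases u with a | ⟨e₁, a, ha⟩ | ⟨e₁, a, ha⟩
    · exact h2.elim
    · obtain ⟨rfl, rfl⟩ := h2
      exact hu
    · exact h2.elim

/-- Each final arc traces back to an arc out of v^{vw} whose end determines x, and v^{vw} has
out-degree at most one in S because its in-degree is at most one. -/
theorem adj_star_unique (hD : ∀ v, ¬ D.Adj v v) (hle : S ≤ D.W) (hE : S.IsEulerian) {e : D.Arc}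
    {x y : V} {hx : x ∈ symmDiff (D.nbr e.tail) (D.nbr e.head)}
    {hy : y ∈ symmDiff (D.nbr e.tail) (D.nbr e.head)}
    (h1 : S.Adj (.sector e x hx) (.star x)) (h2 : S.Adj (.sector e y hy) (.star y)) : x = y := by
  have ht := tail_mem_symmDiff hD e
  have key : ∀ z hz, S.Adj (.sector e z hz) (.star z) → ∃ u, S.Adj (.sector e e.tail ht) u ∧
      (u = .sector e z hz ∨ ∃ h, u = .mid e z h) := by
    intro z hz h
    by_cases h' : z ∈ D.nbr e.tail \ D.nbr e.head
    · exact ⟨_, (adj_tail_sector_iff hle hE h' hz ht).2 h, Or.inl rfl⟩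
    · have h'' := mem_diff_closedNbr hz (hle h).1 h'
      exact ⟨_, (adj_tail_mid_iff hle hE h'' hz ht).2 h, Or.inr ⟨h'', rfl⟩⟩
  obtain ⟨u, hu, hu'⟩ := key x hx h1
  obtain ⟨w, hw, hw'⟩ := key y hy h2
  have := hE.out_unique (in_tail_subsingleton hle e ht) hu hw
  subst this
  rcases hu' with rfl | ⟨_, rfl⟩ <;> simp_all

theorem adj_star_tail_iff (hle : S ≤ D.W) (hE : S.IsEulerian) (e : D.Arc)
    (ht : e.tail ∈ symmDiff (D.nbr e.tail) (D.nbr e.head)) :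
    S.Adj (.star e.tail) (.sector e e.tail ht) ↔ ∃ x hx, S.Adj (.sector e x hx) (.star x) := by
  have h := hE.exists_out_iff_exists_in (.sector e e.tail ht)
  constructor
  · intro h1
    obtain ⟨u, hu⟩ := h.2 ⟨_, h1⟩
    have h2 := hle hu
    rcases u with a | ⟨e₁, a, ha⟩ | ⟨e₁, a, ha⟩
    · exact absurd rfl h2.1
    · obtain ⟨rfl, -, h3⟩ := h2
      exact ⟨a, ha, (adj_tail_sector_iff hle hE h3 ha ht).1 hu⟩
    · obtain ⟨rfl, -⟩ := h2
      exact ⟨a, mem_symmDiff_of_mem_diff_closedNbr ha, (adj_tail_mid_iff hle hE ha _ ht).1 hu⟩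
  · rintro ⟨x, hx, h1⟩
    have : ∃ u, S.Adj (.sector e e.tail ht) u := by
      by_cases h' : x ∈ D.nbr e.tail \ D.nbr e.head
      · exact ⟨_, (adj_tail_sector_iff hle hE h' hx ht).2 h1⟩
      · exact ⟨_, (adj_tail_mid_iff hle hE (mem_diff_closedNbr hx (hle h1).1 h') hx ht).2 h1⟩
    obtain ⟨u, hu⟩ := h.1 this
    have h2 := hle hu
    rcases u with a | ⟨e₁, a, ha⟩ | ⟨e₁, a, ha⟩
    · obtain ⟨rfl, -⟩ := h2
      exact hu
    · obtain ⟨rfl, -, h2⟩ := h2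
      exact absurd rfl (ne_tail_of_mem_diff h2)
    · obtain ⟨rfl, rfl⟩ := h2
      exact absurd rfl (ne_tail_of_mem_diff_closedNbr ha)

open Classical in
theorem exists_pathDigraph_eq (hD : ∀ v, ¬ D.Adj v v) (hle : S ≤ D.W) (hE : S.IsEulerian) :
    ∃ t : D.ExpansionTerm, pathDigraph t = S := by
  have hex : ∀ e : D.Arc, ∃ u : {u : V // u ∈ symmDiff (D.nbr e.tail) (D.nbr e.head)},
      ∀ x hx, S.Adj (.sector e x hx) (.star x) ↔ x ≠ e.tail ∧ x = u := by
    intro e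
    by_cases h : ∃ x hx, S.Adj (.sector e x hx) (.star x)
    · obtain ⟨x, hx, h⟩ := h
      refine ⟨⟨x, hx⟩, fun y hy => ⟨fun h' => ⟨(hle h').1, adj_star_unique hD hle hE h' h⟩, ?_⟩⟩
      rintro ⟨-, rfl⟩
      exact h
    -- When S has no path for this arc, the tail is the choice that stands for the empty path.
    · refine ⟨⟨e.tail, tail_mem_symmDiff hD e⟩, fun y hy => ⟨fun h' => absurd ⟨y, hy, h'⟩ h, ?_⟩⟩
      rintro ⟨h1, h2⟩
      exact absurd h2 h1
  choose t ht using hex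
  refine ⟨t, ?_⟩
  ext u w
  -- Both digraphs lie in 𝒲(D), so comparing them on its five kinds of arcs is enough.
  suffices D.W.Adj u w → ((pathDigraph t).Adj u w ↔ S.Adj u w) from
    ⟨fun h => (this (pathDigraph_le t h)).1 h, fun h => (this (hle h)).2 h⟩
  intro hW
  rcases u with a | ⟨e, x, hx⟩ | ⟨e, x, hx⟩ <;>
    rcases w with b | ⟨e', y, hy⟩ | ⟨e', y, hy⟩ <;> try exact hW.elim
  · obtain ⟨rfl, rfl⟩ := hW
    rw [adj_star_tail_iff hle hE]
    constructor
    · rintro ⟨-, -, h⟩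
      exact ⟨_, _, (ht e' (t e') (t e').2).2 ⟨h, rfl⟩⟩
    · rintro ⟨x, hx, h⟩
      obtain ⟨h1, h2⟩ := (ht e' x hx).1 h
      exact ⟨rfl, rfl, h2 ▸ h1⟩
  · obtain ⟨hne, rfl⟩ := hW
    rw [ht]
    exact ⟨fun h => ⟨h.1, h.2.2⟩, fun h => ⟨h.1, rfl, h.2⟩⟩
  · obtain ⟨rfl, rfl, h⟩ := hW
    rw [adj_tail_sector_iff hle hE h, ht]
    exact ⟨fun h' => ⟨ne_tail_of_mem_diff h, h'.2.2.1⟩, fun h' => ⟨rfl, rfl, h'.2, h⟩⟩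
  · obtain ⟨rfl, rfl⟩ := hW
    rw [adj_tail_mid_iff hle hE hy (mem_symmDiff_of_mem_diff_closedNbr hy), ht]
    exact ⟨fun h' => ⟨ne_tail_of_mem_diff_closedNbr hy, h'.2.2⟩, fun h' => ⟨rfl, rfl, h'.2⟩⟩
  · obtain ⟨rfl, rfl⟩ := hW
    rw [adj_mid_sector_iff hle hE hx hy, ht]
    exact ⟨fun h' => ⟨ne_tail_of_mem_diff_closedNbr hx, h'.2.2⟩, fun h' => ⟨rfl, rfl, h'.2⟩⟩

end Surjective

/-! ### Number of arcs and sign -/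

section ArcCount

open Classical in
/-- The arcs of `pathDigraph t` that belong to the arc `e` of `D`. -/
noncomputable def pathArcs (hD : ∀ v, ¬ D.Adj v v) (t : D.ExpansionTerm) (e : D.Arc) :
    Finset (D.WVertex × D.WVertex) :=
  if h : (t e : V) = e.tail then ∅
  else if h' : (t e : V) ∈ D.nbr e.tail \ D.nbr e.head then
    {(.star e.tail, .sector e e.tail (tail_mem_symmDiff hD e)),
      (.sector e e.tail (tail_mem_symmDiff hD e), .sector e (t e) (t e).2),
      (.sector e (t e) (t e).2, .star (t e))}
  else
    {(.star e.tail, .sector e e.tail (tail_mem_symmDiff hD e)),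
      (.sector e e.tail (tail_mem_symmDiff hD e),
        .mid e (t e) (mem_diff_closedNbr (t e).2 h h')),
      (.mid e (t e) (mem_diff_closedNbr (t e).2 h h'), .sector e (t e) (t e).2),
      (.sector e (t e) (t e).2, .star (t e))}

/-- The arc of `D` to which a vertex of `𝒲(D)` belongs, if any. -/
def WVertex.arc? : D.WVertex → Option D.Arc
  | .star _ => none
  | .sector e _ _ => some e
  | .mid e _ _ => some e

/-- Some end of every arc of the union is not a star vertex and so names an arc of D. This label
makes the sets `pathArcs` a partition, and the number of arcs a sum over the arcs of D. -/
theorem mem_pathArcs_iff (hD : ∀ v, ¬ D.Adj v v) (t : D.ExpansionTerm) (e : D.Arc)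
    (p : D.WVertex × D.WVertex) :
    p ∈ pathArcs hD t e ↔ (pathDigraph t).Adj p.1 p.2 ∧ (p.1.arc?.or p.2.arc?) = some e := by
  have h1 : (t e : V) ∈ D.nbr e.tail \ D.nbr e.head → (t e : V) ≠ e.tail := ne_tail_of_mem_diff
  have h2 := @ne_tail_of_mem_diff_closedNbr V D e (t e)
  unfold pathArcs
  rcases p with ⟨a | ⟨e₁, a, ha⟩ | ⟨e₁, a, ha⟩, b | ⟨e₂, b, hb⟩ | ⟨e₂, b, hb⟩⟩ <;>
    split_ifs with h h' <;> simp [pathDigraph, WVertex.arc?] <;>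
    grind [closedNbr]

theorem arcCount_pathDigraph [Fintype D.Arc] (hD : ∀ v, ¬ D.Adj v v) (t : D.ExpansionTerm) :
    (pathDigraph t).arcCount = ∑ e, (pathArcs hD t e).card := by
  classical
  rw [← Finset.card_biUnion, ← Set.ncard_coe_finset]
  · unfold arcCount
    congr 1
    ext ⟨p, q⟩
    simp only [Set.mem_ofPred_eq, Finset.coe_biUnion, Set.mem_iUnion, Finset.mem_coe,
      mem_pathArcs_iff, Finset.mem_univ, exists_true_left]
    refine ⟨fun h => ?_, fun ⟨e, h⟩ => h.1⟩
    rcases p with a | ⟨e, a, ha⟩ | ⟨e, a, ha⟩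
    · rcases q with b | ⟨e', b, hb⟩ | ⟨e', b, hb⟩
      · exact h.elim
      · exact ⟨e', h, rfl⟩
      · exact h.elim
    · exact ⟨e, h, rfl⟩
    · exact ⟨e, h, rfl⟩
  · intro e _ e' _ hne
    refine Finset.disjoint_left.2 fun p h h' => hne ?_
    rw [mem_pathArcs_iff] at h h'
    exact Option.some_injective _ (h.2.symm.trans h'.2)

/-- The subdivision by y_u^{vw} exists for this: 0 or 4 arcs for a positive variable, 3 for a
negative one. -/
theorem signedVar_eq [Fintype V] (hD : ∀ v, ¬ D.Adj v v) (t : D.ExpansionTerm) (e : D.Arc) :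
    D.signedVar e (t e) =
      (MvPolynomial.monomial (Finsupp.single (t e : V) 1)) ((-1) ^ (pathArcs hD t e).card) := by
  classical
  have hcard : (-1 : ℝ) ^ (pathArcs hD t e).card =
      if (t e : V) ∈ D.nbr e.head \ D.nbr e.tail then 1 else -1 := by
    unfold pathArcs
    split_ifs with h h1 h' h1 h1
    · simp
    · exact absurd ⟨h.symm ▸ tail_mem_nbr_head e, h.symm ▸ notMem_nbr_self hD _⟩ h1
    · exact absurd h1.1 h'.2
    · rw [Finset.card_eq_three.2 ⟨_, _, _, ?_, ?_, ?_, rfl⟩]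
      · norm_num
      all_goals simp [Ne.symm h]
    · rw [Finset.card_insert_of_notMem, Finset.card_insert_of_notMem,
        Finset.card_insert_of_notMem, Finset.card_singleton]
      · norm_num
      all_goals simp
    · have := mem_diff_closedNbr (t e).2 h h'
      exact absurd ⟨this.1, fun h => this.2 (Or.inl h)⟩ h1
  rw [hcard]
  unfold signedVar
  split_ifs
  · rfl
  · rw [map_neg]
    rfl

end ArcCount

/-! ### Values of terms, the bijection and the coefficient -/

section Value

variable [Fintype V]

/-- The exponents of the monomial to which the term `t` contributes. -/
noncomputable def ExpansionTerm.exponent (t : D.ExpansionTerm) : V →₀ ℕ :=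
  Finsupp.equivFunOnFinite.symm fun v => {e : D.Arc | (t e : V) = v}.ncard

theorem ExpansionTerm.value_eq (hD : ∀ v, ¬ D.Adj v v) (t : D.ExpansionTerm) :
    t.value = MvPolynomial.monomial t.exponent ((-1) ^ (pathDigraph t).arcCount) := by
  classical
  have hexp : t.exponent = ∑ e : D.Arc, Finsupp.single (t e : V) 1 := by
    ext v
    simp only [exponent, Finsupp.equivFunOnFinite_symm_apply_apply, Finsupp.finsetSum_apply,
      Finsupp.single_apply, Finset.sum_boole, Nat.cast_id]
    rw [← Set.ncard_coe_finset]
    simp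
  unfold value
  rw [hexp, arcCount_pathDigraph hD, ← Finset.prod_pow_eq_pow_sum, MvPolynomial.monomial_sum_prod]
  exact Finset.prod_congr rfl fun e _ => signedVar_eq hD t e

theorem Mf_eq : D.Mf = MvPolynomial.monomial (Finsupp.equivFunOnFinite.symm D.outDeg) 1 := by
  rw [MvPolynomial.monomial_eq]
  simp [Mf, Finsupp.prod_fintype]

theorem ExpansionTerm.exponent_eq_iff (hD : ∀ v, ¬ D.Adj v v) (t : D.ExpansionTerm) :
    t.exponent = Finsupp.equivFunOnFinite.symm D.outDeg ↔ (pathDigraph t).IsEulerian := by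
  rw [pathDigraph_isEulerian_iff hD, exponent, Equiv.apply_eq_iff_eq, funext_iff]

theorem ExpansionTerm.value_eq_Mf_iff (hD : ∀ v, ¬ D.Adj v v) (t : D.ExpansionTerm) :
    t.value = D.Mf ↔ (pathDigraph t).IsEulerian ∧ Even (pathDigraph t).arcCount := by
  rw [t.value_eq hD, Mf_eq, MvPolynomial.monomial_eq_monomial_iff, t.exponent_eq_iff hD]
  simp [neg_one_pow_eq_one_iff_even (show (-1 : ℝ) ≠ 1 by norm_num)]

theorem ExpansionTerm.value_eq_neg_Mf_iff (hD : ∀ v, ¬ D.Adj v v) (t : D.ExpansionTerm) :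
    t.value = -D.Mf ↔ (pathDigraph t).IsEulerian ∧ Odd (pathDigraph t).arcCount := by
  rw [t.value_eq hD, Mf_eq, ← map_neg, MvPolynomial.monomial_eq_monomial_iff,
    t.exponent_eq_iff hD]
  simp [neg_one_pow_eq_neg_one_iff_odd (show (-1 : ℝ) ≠ 1 by norm_num)]

theorem ExpansionTerm.value_eq_or_iff (hD : ∀ v, ¬ D.Adj v v) (t : D.ExpansionTerm) :
    (t.value = D.Mf ∨ t.value = -D.Mf) ↔ (pathDigraph t).IsEulerian := by
  rw [t.value_eq_Mf_iff hD, t.value_eq_neg_Mf_iff hD, ← and_or_left]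
  exact and_iff_left (Nat.even_or_odd _)

/-- The bijection `t ↦ pathDigraph t` between the terms `±M_f` and the spanning Eulerian
subdigraphs of `𝒲(D)`. -/
noncomputable def occurrenceEquiv (hD : ∀ v, ¬ D.Adj v v) :
    D.MfOccurrence ≃ D.W.SpanningEulerian :=
  Equiv.ofBijective
    (fun t => ⟨pathDigraph t.1, pathDigraph_le t.1, (t.1.value_eq_or_iff hD).1 t.2⟩) <| by
    constructor
    · intro t t' h
      exact Subtype.ext (pathDigraph_injective (congrArg Subtype.val h))
    · rintro ⟨S, hle, hE⟩
      obtain ⟨t, rfl⟩ := exists_pathDigraph_eq hD hle hE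
      exact ⟨⟨t, (t.value_eq_or_iff hD).2 hE⟩, rfl⟩

theorem EE_W_eq (hD : ∀ v, ¬ D.Adj v v) :
    D.W.EE = Nat.card {t : D.ExpansionTerm // t.value = D.Mf} := by
  refine Nat.card_congr (Equiv.trans (β := {t : D.MfOccurrence // t.1.value = D.Mf}) ?_
    (Equiv.subtypeSubtypeEquivSubtype (fun h => Or.inl h)))
  refine ((occurrenceEquiv hD).subtypeEquiv fun t => ?_).symm
  rw [t.1.value_eq_Mf_iff hD]
  exact and_iff_right ((t.1.value_eq_or_iff hD).1 t.2)

theorem EO_W_eq (hD : ∀ v, ¬ D.Adj v v) :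
    D.W.EO = Nat.card {t : D.ExpansionTerm // t.value = -D.Mf} := by
  refine Nat.card_congr (Equiv.trans (β := {t : D.MfOccurrence // t.1.value = -D.Mf}) ?_
    (Equiv.subtypeSubtypeEquivSubtype (fun h => Or.inr h)))
  refine ((occurrenceEquiv hD).subtypeEquiv fun t => ?_).symm
  rw [t.1.value_eq_neg_Mf_iff hD]
  exact and_iff_right ((t.1.value_eq_or_iff hD).1 t.2)

open Classical in
-- A term is a monomial with coefficient ±1, so it contributes to the coefficient of M_f only when
-- it equals M_f or -M_f.
theorem ExpansionTerm.coeff_value (hD : ∀ v, ¬ D.Adj v v) (t : D.ExpansionTerm) :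
    t.value.coeff (Finsupp.equivFunOnFinite.symm D.outDeg) =
      (if t.value = D.Mf then 1 else 0) - if t.value = -D.Mf then 1 else 0 := by
  simp only [t.value_eq_Mf_iff hD, t.value_eq_neg_Mf_iff hD]
  rw [t.value_eq hD, MvPolynomial.coeff_monomial]
  simp only [t.exponent_eq_iff hD]
  rcases Nat.even_or_odd (pathDigraph t).arcCount with h | h
  · simp [h, h.neg_one_pow, Nat.not_odd_iff_even.2 h]
  · rw [h.neg_one_pow]
    by_cases hE : (pathDigraph t).IsEulerian <;> simp [h, hE, Nat.not_even_iff_odd.2 h]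

theorem coeff_f_eq (hD : ∀ v, ¬ D.Adj v v) :
    MvPolynomial.coeff (Finsupp.equivFunOnFinite.symm D.outDeg) D.f =
      (D.W.EE : ℝ) - (D.W.EO : ℝ) := by
  classical
  rw [f_eq_sum_expansionTerm, MvPolynomial.coeff_sum, EE_W_eq hD, EO_W_eq hD,
    Nat.card_eq_fintype_card, Nat.card_eq_fintype_card, Fintype.card_subtype, Fintype.card_subtype,
    ← Finset.sum_boole, ← Finset.sum_boole, ← Finset.sum_sub_distrib]
  exact Finset.sum_congr rfl fun t _ => by convert t.coeff_value hD

end Value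

end Digraph

theorem theorem4p1 {V : Type*} [Fintype V] (D : Digraph V) (hD : ∀ v, ¬ D.Adj v v) :
    (∃ Φ : D.MfOccurrence ≃ D.W.SpanningEulerian, ∀ t : D.MfOccurrence,
        (Digraph.ExpansionTerm.value t.1 = D.Mf ↔ Even (Φ t).1.arcCount) ∧
        (Digraph.ExpansionTerm.value t.1 = -D.Mf ↔ Odd (Φ t).1.arcCount)) ∧
      MvPolynomial.coeff (Finsupp.equivFunOnFinite.symm D.outDeg) D.f =
        (D.W.EE : ℝ) - (D.W.EO : ℝ) := by
  refine ⟨⟨Digraph.occurrenceEquiv hD, fun t => ?_⟩, Digraph.coeff_f_eq hD⟩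
  have hE := (t.1.value_eq_or_iff hD).1 t.2
  rw [t.1.value_eq_Mf_iff hD, t.1.value_eq_neg_Mf_iff hD]
  exact ⟨and_iff_right hE, and_iff_right hE⟩
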